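/- \textbf{Theorem.} Let $\mathcal{L}=\mathcal{L}(\mathcal{F},\mathcal{G})$ be any signature of normal lattice expansions (LE-signature): $\mathcal{F}$ and $\mathcal{G}$ are disjoint sets of connectives, each $h\in\mathcal{F}\cup\mathcal{G}$ with an arity $n_h\in\mathbb{N}$ and an order type $\varepsilon_h\in\{1,\partial\}^{n_h}$; and let $\mathsf{AtProp}$ be any set of proposition letters. For every set $R$ of analytic structural rules, the calculus $\mathrm{D.LE}'$ obtained by adding the rules of $R$ to the display calculus $\mathrm{D.LE}$ has cut elimination: for every sequent $x\Rightarrow y$, if $\vdash_{\mathrm{D.LE}'}x\Rightarrow y$ then $\vdash_{\mathrm{cfD.LE}'}x\Rightarrow y$, where $\mathrm{cfD.LE}'$ is $\mathrm{D.LE}'$ without the rule $(\mathrm{Cut})$. \emph{Language.} Formulas are $\varphi::=p\mid\bot\mid\top\mid\varphi\wedge\varphi\mid\varphi\vee\varphi\mid f(\overline{\varphi})\mid g(\overline{\varphi})$ with $p\in\mathsf{AtProp}$, $f\in\mathcal{F}$, $g\in\mathcal{G}$. The set $\mathcal{F}^*$ consists of $\mathcal{F}$, all $f^\sharp_i$ with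 $\varepsilon_f(i)=\partial$ and all $g^\flat_i$ with $\varepsilon_g(i)=1$; $\mathcal{G}^*$ consists of $\mathcal{G}$, all $f^\sharp_i$ with $\varepsilon_f(i)=1$ and all $g^\flat_i$ with $\varepsilon_g(i)=\partial$ ($f\in\mathcal F$, $g\in\mathcal G$, $1\le i\le n_f$, resp. $1\le i\le n_g$). The arity of $h_i^{\sharp}$, resp. $h_i^\flat$, is $n_h$; its order type has $i$-th entry $\varepsilon_h(i)$ and, for $j\neq i$, $j$-th entry opposite to $\varepsilon_h(j)$ if $\varepsilon_h(i)=1$, and equal to $\varepsilon_h(j)$ if $\varepsilon_h(i)=\partial$. Structures are given by $\mathsf{Str}_\mathcal{F}\ni x::=\varphi\mid\mathsf{F}_f(\overline{x})$ for $f\in\mathcal{F}^*$ and $\mathsf{Str}_\mathcal{G}\ni y::=\varphi\mid\mathsf{G}_g(\overline{y})$ for $g\in\mathcal{G}^*$, where an argument in a coordinate with order-type entry $1$ is a structure of the same sort and an argument in a coordinate with entry $\partial$ is one of the other sort. Sequents are $x\Rightarrow y$ with $x\in\mathsf{Str}_\mathcal{F}$, $y\in\mathsf{Str}_\mathcal{G}$.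 \emph{The calculus $\mathrm{D.LE}$.} Write $\overline{x}^{\,i}_{z}$ for $\overline{x}$ with its $i$-th entry replaced by $z$. For all $f\in\mathcal{F}$, $g\in\mathcal{G}$, formulas $p,\varphi,\psi,\varphi_i,\psi_i$ ($p\in\mathsf{AtProp}$) and structures $x,y,\overline{x},\overline{y}$ of the appropriate sorts: \begin{itemize} \item $(\mathrm{Id})$: $p\Rightarrow p$; $(\mathrm{Cut})$: from $x\Rightarrow\varphi$ and $\varphi\Rightarrow y$ infer $x\Rightarrow y$. \item Display rules, invertible: $\mathsf{F}_f(\overline{x})\Rightarrow y$ is interderivable with $x_i\Rightarrow\mathsf{G}_{f^\sharp_i}(\overline{x}^{\,i}_{y})$ if $\varepsilon_f(i)=1$, and with $\mathsf{F}_{f^\sharp_i}(\overline{x}^{\,i}_{y})\Rightarrow x_i$ if $\varepsilon_f(i)=\partial$; $x\Rightarrow\mathsf{G}_g(\overline{y})$ is interderivable with $\mathsf{F}_{g^\flat_i}(\overline{y}^{\,i}_{x})\Rightarrow y_i$ if $\varepsilon_g(i)=1$, and with $y_i\Rightarrow\mathsf{G}_{g^\flat_i}(\overline{y}^{\,i}_{x})$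 if $\varepsilon_g(i)=\partial$. \item Lattice rules: $\bot\Rightarrow y$; $x\Rightarrow\top$; from $\varphi\Rightarrow y$, or from $\psi\Rightarrow y$, infer $\varphi\wedge\psi\Rightarrow y$; from $x\Rightarrow\varphi$ and $x\Rightarrow\psi$ infer $x\Rightarrow\varphi\wedge\psi$; from $x\Rightarrow\varphi$, or from $x\Rightarrow\psi$, infer $x\Rightarrow\varphi\vee\psi$; from $\varphi\Rightarrow y$ and $\psi\Rightarrow y$ infer $\varphi\vee\psi\Rightarrow y$. \item From $\mathsf{F}_f(\overline{\varphi})\Rightarrow y$ infer $f(\overline{\varphi})\Rightarrow y$; from all $x_i\Rightarrow\varphi_i$ with $\varepsilon_f(i)=1$ and all $\varphi_j\Rightarrow x_j$ with $\varepsilon_f(j)=\partial$ infer $\mathsf{F}_f(\overline{x})\Rightarrow f(\overline{\varphi})$; from $x\Rightarrow\mathsf{G}_g(\overline{\psi})$ infer $x\Rightarrow g(\overline{\psi})$; from all $\psi_i\Rightarrow y_i$ with $\varepsilon_g(i)=1$ and all $y_j\Rightarrow\psi_j$ with $\varepsilon_g(j)=\partial$ infer $g(\overline{\psi})\Rightarrow\mathsf{G}_g(\overline{y})$.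 \end{itemize} \emph{Analytic structural rules.} Metastructures of the two sorts are built in the same way as structures, but from metavariables $X_0,X_1,\dots$ (of sort $\mathcal{F}$) and $Y_0,Y_1,\dots$ (of sort $\mathcal{G}$) instead of formulas. A structural rule consists of finitely many (possibly no) premises $S_1\Rightarrow T_1,\dots,S_n\Rightarrow T_n$ and a conclusion $S_0\Rightarrow T_0$, where the $S_k$ and $T_k$ are metastructures of sort $\mathcal{F}$ and $\mathcal{G}$, respectively; its instances are obtained by replacing metavariables by arbitrary structures of the same sort. It is analytic if every metavariable that occurs in a premise occurs in the conclusion, and every metavariable occurs at most once in the conclusion. -/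

import Mathlib

universe u v w

/-- The two possible entries of an order type. -/
inductive OrdSign : Type
  | one
  | dual
  deriving DecidableEq

namespace OrdSign

/-- The opposite sign. -/
def opp : OrdSign → OrdSign
  | one => dual
  | dual => one

end OrdSign

/-- The two sorts of structures: `F`-structures occur in precedent position,
`G`-structures occur in succedent position. -/
inductive Side : Type
  | F
  | G
  deriving DecidableEq

namespace Side

/-- The sort of an argument with order-type entry `e`, in a structure of sort `s`:
the same sort if `e = 1`, the other sort if `e = ∂`. -/
def arg : Side → OrdSign → Side
  | s, .one => s
  | .F, .dual => .G
  | .G, .dual => .F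

end Side

/-- A signature of normal lattice expansions: two (disjoint) families of connectives, each
connective having a finite arity and an order type over its arity. -/
structure LESignature : Type (max u v + 1) where
  F : Type u
  G : Type v
  arF : F → ℕ
  arG : G → ℕ
  ordF : (f : F) → Fin (arF f) → OrdSign
  ordG : (g : G) → Fin (arG g) → OrdSign

/-- The order type of the residual (or Galois adjoint) in coordinate `i` of a connective with
order type `ε`: the `i`-th entry is `ε i`; the `j`-th entry, `j ≠ i`, is the opposite of `ε j` if
`ε i = 1`, and is `ε j` if `ε i = ∂`. -/
def adjOrd {n : ℕ} (ε : Fin n → OrdSign) (i : Fin n) : Fin n → OrdSign := fun j =>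
  if j = i then ε i else
    match ε i with
    | .one => (ε j).opp
    | .dual => ε j

namespace LESignature

/-- The connectives of the expanded ("tense") language: `Star .F` is `F*` and `Star .G` is `G*`.
The connective `f♯ᵢ` is in `G*` if `ε_f(i) = 1` and in `F*` if `ε_f(i) = ∂`; the connective `g♭ᵢ`
is in `F*` if `ε_g(i) = 1` and in `G*` if `ε_g(i) = ∂`. -/
inductive Star (L : LESignature) : Side → Type _
  | opF (f : L.F) : Star L .F
  | opG (g : L.G) : Star L .G
  | sharpG (f : L.F) (i : Fin (L.arF f)) (h : L.ordF f i = .one) : Star L .G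
  | sharpF (f : L.F) (i : Fin (L.arF f)) (h : L.ordF f i = .dual) : Star L .F
  | flatF (g : L.G) (i : Fin (L.arG g)) (h : L.ordG g i = .one) : Star L .F
  | flatG (g : L.G) (i : Fin (L.arG g)) (h : L.ordG g i = .dual) : Star L .G

namespace Star

variable {L : LESignature}

/-- The arity of a connective of the expanded language. -/
def arity : {s : Side} → L.Star s → ℕ
  | _, opF f => L.arF f
  | _, opG g => L.arG g
  | _, sharpG f _ _ => L.arF f
  | _, sharpF f _ _ => L.arF f
  | _, flatF g _ _ => L.arG g
  | _, flatG g _ _ => L.arG g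

/-- The order type of a connective of the expanded language. -/
def ord : {s : Side} → (c : L.Star s) → Fin c.arity → OrdSign
  | _, opF f => L.ordF f
  | _, opG g => L.ordG g
  | _, sharpG f i _ => adjOrd (L.ordF f) i
  | _, sharpF f i _ => adjOrd (L.ordF f) i
  | _, flatF g i _ => adjOrd (L.ordG g) i
  | _, flatG g i _ => adjOrd (L.ordG g) i

end Star

/-- Formulas of the language over the proposition letters `P`. -/
inductive Fm (L : LESignature) (P : Type*) : Type _
  | prop (p : P) : Fm L P
  | bot : Fm L P
  | top : Fm L P
  | and (φ ψ : Fm L P) : Fm L P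
  | or (φ ψ : Fm L P) : Fm L P
  | opF (f : L.F) (φ : Fin (L.arF f) → Fm L P) : Fm L P
  | opG (g : L.G) (φ : Fin (L.arG g) → Fm L P) : Fm L P

/-- Structures: `Str .F` and `Str .G` are the two sorts of structures, built from formulas by the
structural connectives associated with `F*` and `G*`. -/
inductive Str (L : LESignature) (P : Type*) : Side → Type _
  | fm {s : Side} (φ : Fm L P) : Str L P s
  | con {s : Side} (c : L.Star s) (x : (i : Fin c.arity) → Str L P (s.arg (c.ord i))) : Str L P s

/-- Metastructures, built from metavariables of the two sorts (the metavariables of each sort are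
indexed by `ℕ`) by the structural connectives. -/
inductive MStr (L : LESignature) : Side → Type _
  | var {s : Side} (k : ℕ) : MStr L s
  | con {s : Side} (c : L.Star s) (x : (i : Fin c.arity) → MStr L (s.arg (c.ord i))) : MStr L s

/-- Sequents `x ⇒ y`. -/
structure Sequent (L : LESignature) (P : Type*) where
  ant : L.Str P .F
  suc : L.Str P .G

/-- Metasequents `S ⇒ T`. -/
structure MSequent (L : LESignature) where
  ant : L.MStr .F
  suc : L.MStr .G

/-- A structural rule, with finitely many (possibly no) premises. -/
structure StructRule (L : LESignature) where
  premises : List L.MSequent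
  conclusion : L.MSequent

section

variable {L : LESignature} {P : Type*}

/-- Instantiation of metavariables by structures of the same sort. -/
def MStr.subst (σ : (s : Side) → ℕ → L.Str P s) : {s : Side} → L.MStr s → L.Str P s
  | s, .var k => σ s k
  | _, .con c x => .con c fun i => (x i).subst σ

/-- Instantiation of a metasequent. -/
def MSequent.subst (σ : (s : Side) → ℕ → L.Str P s) (S : L.MSequent) : L.Sequent P :=
  ⟨S.ant.subst σ, S.suc.subst σ⟩

/-- The number of occurrences of the `k`-th metavariable of sort `t` in a metastructure. -/
def MStr.occ (t : Side) (k : ℕ) : {s : Side} → L.MStr s → ℕ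
  | s, .var m => if s = t ∧ m = k then 1 else 0
  | _, .con _ x => ∑ i, (x i).occ t k

/-- The number of occurrences of the `k`-th metavariable of sort `t` in a metasequent. -/
def MSequent.occ (t : Side) (k : ℕ) (S : L.MSequent) : ℕ :=
  S.ant.occ t k + S.suc.occ t k

/-- Analytic structural rules (conditions C₁ to C₇). The parameters of a rule are its metavariables,
two occurrences being congruent iff they are occurrences of the same metavariable, so that
congruent parameters have the same shape (C₂). A metavariable of sort `F` occurs only in
precedent position and a metavariable of sort `G` only in succedent position, so the sorting
gives C₄. There are no formulas in a structural rule, so C₅ is void, and metavariables are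
instantiated by arbitrary structures, so C₆ and C₇ hold. The remaining conditions are
C₁ (what occurs in a premise occurs in the conclusion) and C₃ (a parameter is congruent to at
most one parameter of the conclusion). -/
structure StructRule.IsAnalytic (r : L.StructRule) : Prop where
  preservation : ∀ S ∈ r.premises, ∀ (t : Side) (k : ℕ), 0 < S.occ t k → 0 < r.conclusion.occ t k
  nonproliferation : ∀ (t : Side) (k : ℕ), r.conclusion.occ t k ≤ 1

/-- Transport of a structure along an equality of sorts. -/
def Str.cast {s t : Side} (h : s = t) (x : L.Str P s) : L.Str P t := h ▸ x

/-- Replace the `i`-th entry of the tuple `x` by `y`; the sorts of all other entries agree. -/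
def Str.replace {n : ℕ} {A B : Fin n → Side} (x : (j : Fin n) → L.Str P (A j)) (i : Fin n)
    {s : Side} (y : L.Str P s) (hi : s = B i) (hj : ∀ j, j ≠ i → A j = B j) :
    (j : Fin n) → L.Str P (B j) := fun j =>
  if h : j = i then Str.cast (hi.trans (congrArg B h.symm)) y else Str.cast (hj j h) (x j)

theorem arg_adj_self {n : ℕ} (ε : Fin n → OrdSign) (i : Fin n) (s : Side) :
    s.arg (adjOrd ε i i) = s.arg (ε i) := by
  simp [adjOrd]

theorem arg_adj_one {n : ℕ} (ε : Fin n → OrdSign) (i j : Fin n) (s t : Side) (hst : s ≠ t)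
    (h : ε i = .one) (hj : j ≠ i) : s.arg (ε j) = t.arg (adjOrd ε i j) := by
  cases s <;> cases t <;> cases hε : ε j <;> simp_all [adjOrd, Side.arg, OrdSign.opp]

theorem arg_adj_dual {n : ℕ} (ε : Fin n → OrdSign) (i j : Fin n) (s : Side)
    (h : ε i = .dual) (hj : j ≠ i) : s.arg (ε j) = s.arg (adjOrd ε i j) := by
  simp [adjOrd, h, hj]

/-- Tuples of arguments of the structural connective `F_f`. -/
abbrev ArgsF (L : LESignature) (P : Type*) (f : L.F) : Type _ :=
  (i : Fin (L.arF f)) → L.Str P (Side.F.arg (L.ordF f i))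

/-- Tuples of arguments of the structural connective `G_g`. -/
abbrev ArgsG (L : LESignature) (P : Type*) (g : L.G) : Type _ :=
  (i : Fin (L.arG g)) → L.Str P (Side.G.arg (L.ordG g i))

/-- `F_f(x₁, …, xₙ)`. -/
def strF (f : L.F) (x : L.ArgsF P f) : L.Str P .F := .con (.opF f) x

/-- `G_g(y₁, …, yₙ)`. -/
def strG (g : L.G) (y : L.ArgsG P g) : L.Str P .G := .con (.opG g) y

/-- `G_{f♯ᵢ}(x₁, …, xᵢ₋₁, y, xᵢ₊₁, …, xₙ)`, for `ε_f(i) = 1`. -/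
def strSharpG (f : L.F) (i : Fin (L.arF f)) (h : L.ordF f i = .one) (x : L.ArgsF P f)
    (y : L.Str P .G) : L.Str P .G :=
  .con (.sharpG f i h) (Str.replace (B := fun j => Side.G.arg (adjOrd (L.ordF f) i j)) x i y
    (by rw [arg_adj_self, h]; rfl)
    (fun j hj => arg_adj_one _ i j .F .G (by decide) h hj))

/-- `F_{f♯ᵢ}(x₁, …, xᵢ₋₁, y, xᵢ₊₁, …, xₙ)`, for `ε_f(i) = ∂`. -/
def strSharpF (f : L.F) (i : Fin (L.arF f)) (h : L.ordF f i = .dual) (x : L.ArgsF P f)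
    (y : L.Str P .G) : L.Str P .F :=
  .con (.sharpF f i h) (Str.replace (B := fun j => Side.F.arg (adjOrd (L.ordF f) i j)) x i y
    (by rw [arg_adj_self, h]; rfl)
    (fun j hj => arg_adj_dual _ i j .F h hj))

/-- `F_{g♭ᵢ}(y₁, …, yᵢ₋₁, x, yᵢ₊₁, …, yₙ)`, for `ε_g(i) = 1`. -/
def strFlatF (g : L.G) (i : Fin (L.arG g)) (h : L.ordG g i = .one) (y : L.ArgsG P g)
    (x : L.Str P .F) : L.Str P .F :=
  .con (.flatF g i h) (Str.replace (B := fun j => Side.F.arg (adjOrd (L.ordG g) i j)) y i x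
    (by rw [arg_adj_self, h]; rfl)
    (fun j hj => arg_adj_one _ i j .G .F (by decide) h hj))

/-- `G_{g♭ᵢ}(y₁, …, yᵢ₋₁, x, yᵢ₊₁, …, yₙ)`, for `ε_g(i) = ∂`. -/
def strFlatG (g : L.G) (i : Fin (L.arG g)) (h : L.ordG g i = .dual) (y : L.ArgsG P g)
    (x : L.Str P .F) : L.Str P .G :=
  .con (.flatG g i h) (Str.replace (B := fun j => Side.G.arg (adjOrd (L.ordG g) i j)) y i x
    (by rw [arg_adj_self, h]; rfl)
    (fun j hj => arg_adj_dual _ i j .G h hj))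

/-- The `i`-th argument of `F_f(x)`, an `F`-structure if `ε_f(i) = 1`. -/
def argF1 (f : L.F) (i : Fin (L.arF f)) (h : L.ordF f i = .one) (x : L.ArgsF P f) : L.Str P .F :=
  Str.cast (by rw [h]; rfl) (x i)

/-- The `i`-th argument of `F_f(x)`, a `G`-structure if `ε_f(i) = ∂`. -/
def argFd (f : L.F) (i : Fin (L.arF f)) (h : L.ordF f i = .dual) (x : L.ArgsF P f) : L.Str P .G :=
  Str.cast (by rw [h]; rfl) (x i)

/-- The `i`-th argument of `G_g(y)`, a `G`-structure if `ε_g(i) = 1`. -/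
def argG1 (g : L.G) (i : Fin (L.arG g)) (h : L.ordG g i = .one) (y : L.ArgsG P g) : L.Str P .G :=
  Str.cast (by rw [h]; rfl) (y i)

/-- The `i`-th argument of `G_g(y)`, an `F`-structure if `ε_g(i) = ∂`. -/
def argGd (g : L.G) (i : Fin (L.arG g)) (h : L.ordG g i = .dual) (y : L.ArgsG P g) : L.Str P .F :=
  Str.cast (by rw [h]; rfl) (y i)

/-- The sequent between a structure and a formula in which the structure stands on the side of its
sort: `z ⇒ φ` if `z` is an `F`-structure, `φ ⇒ z` if `z` is a `G`-structure. -/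
def seqFm : {s : Side} → L.Str P s → L.Fm P → L.Sequent P
  | .F, x, φ => ⟨x, .fm φ⟩
  | .G, y, φ => ⟨.fm φ, y⟩

end

/-- Derivability in the display calculus extended with the structural rules in `R`, with the cut rule
if `cut = true` and without it if `cut = false`. -/
inductive Derivable {L : LESignature} {P : Type*} (R : Set L.StructRule) (cut : Bool) :
    L.Sequent P → Prop
  -- identity and cut
  | id (p : P) : Derivable R cut ⟨.fm (.prop p), .fm (.prop p)⟩
  | cutRule (hcut : cut = true) (x : L.Str P .F) (φ : L.Fm P) (y : L.Str P .G) :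
      Derivable R cut ⟨x, .fm φ⟩ → Derivable R cut ⟨.fm φ, y⟩ → Derivable R cut ⟨x, y⟩
  -- display rules, in both directions
  | sharpG (f : L.F) (i : Fin (L.arF f)) (h : L.ordF f i = .one) (x : L.ArgsF P f)
      (y : L.Str P .G) :
      Derivable R cut ⟨strF f x, y⟩ → Derivable R cut ⟨argF1 f i h x, strSharpG f i h x y⟩
  | sharpG_inv (f : L.F) (i : Fin (L.arF f)) (h : L.ordF f i = .one) (x : L.ArgsF P f)
      (y : L.Str P .G) :
      Derivable R cut ⟨argF1 f i h x, strSharpG f i h x y⟩ → Derivable R cut ⟨strF f x, y⟩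
  | sharpF (f : L.F) (i : Fin (L.arF f)) (h : L.ordF f i = .dual) (x : L.ArgsF P f)
      (y : L.Str P .G) :
      Derivable R cut ⟨strF f x, y⟩ → Derivable R cut ⟨strSharpF f i h x y, argFd f i h x⟩
  | sharpF_inv (f : L.F) (i : Fin (L.arF f)) (h : L.ordF f i = .dual) (x : L.ArgsF P f)
      (y : L.Str P .G) :
      Derivable R cut ⟨strSharpF f i h x y, argFd f i h x⟩ → Derivable R cut ⟨strF f x, y⟩
  | flatF (g : L.G) (i : Fin (L.arG g)) (h : L.ordG g i = .one) (y : L.ArgsG P g)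
      (x : L.Str P .F) :
      Derivable R cut ⟨x, strG g y⟩ → Derivable R cut ⟨strFlatF g i h y x, argG1 g i h y⟩
  | flatF_inv (g : L.G) (i : Fin (L.arG g)) (h : L.ordG g i = .one) (y : L.ArgsG P g)
      (x : L.Str P .F) :
      Derivable R cut ⟨strFlatF g i h y x, argG1 g i h y⟩ → Derivable R cut ⟨x, strG g y⟩
  | flatG (g : L.G) (i : Fin (L.arG g)) (h : L.ordG g i = .dual) (y : L.ArgsG P g)
      (x : L.Str P .F) :
      Derivable R cut ⟨x, strG g y⟩ → Derivable R cut ⟨argGd g i h y, strFlatG g i h y x⟩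
  | flatG_inv (g : L.G) (i : Fin (L.arG g)) (h : L.ordG g i = .dual) (y : L.ArgsG P g)
      (x : L.Str P .F) :
      Derivable R cut ⟨argGd g i h y, strFlatG g i h y x⟩ → Derivable R cut ⟨x, strG g y⟩
  -- introduction rules for the lattice connectives
  | botL (y : L.Str P .G) : Derivable R cut ⟨.fm .bot, y⟩
  | topR (x : L.Str P .F) : Derivable R cut ⟨x, .fm .top⟩
  | andL₁ (φ ψ : L.Fm P) (y : L.Str P .G) :
      Derivable R cut ⟨.fm φ, y⟩ → Derivable R cut ⟨.fm (.and φ ψ), y⟩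
  | andL₂ (φ ψ : L.Fm P) (y : L.Str P .G) :
      Derivable R cut ⟨.fm ψ, y⟩ → Derivable R cut ⟨.fm (.and φ ψ), y⟩
  | andR (φ ψ : L.Fm P) (x : L.Str P .F) :
      Derivable R cut ⟨x, .fm φ⟩ → Derivable R cut ⟨x, .fm ψ⟩ →
      Derivable R cut ⟨x, .fm (.and φ ψ)⟩
  | orR₁ (φ ψ : L.Fm P) (x : L.Str P .F) :
      Derivable R cut ⟨x, .fm φ⟩ → Derivable R cut ⟨x, .fm (.or φ ψ)⟩
  | orR₂ (φ ψ : L.Fm P) (x : L.Str P .F) :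
      Derivable R cut ⟨x, .fm ψ⟩ → Derivable R cut ⟨x, .fm (.or φ ψ)⟩
  | orL (φ ψ : L.Fm P) (y : L.Str P .G) :
      Derivable R cut ⟨.fm φ, y⟩ → Derivable R cut ⟨.fm ψ, y⟩ →
      Derivable R cut ⟨.fm (.or φ ψ), y⟩
  -- introduction rules for the additional connectives
  | fL (f : L.F) (φ : Fin (L.arF f) → L.Fm P) (y : L.Str P .G) :
      Derivable R cut ⟨strF f fun i => .fm (φ i), y⟩ → Derivable R cut ⟨.fm (.opF f φ), y⟩
  | fR (f : L.F) (φ : Fin (L.arF f) → L.Fm P) (x : L.ArgsF P f) :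
      (∀ i, Derivable R cut (seqFm (x i) (φ i))) → Derivable R cut ⟨strF f x, .fm (.opF f φ)⟩
  | gL (g : L.G) (ψ : Fin (L.arG g) → L.Fm P) (x : L.Str P .F) :
      Derivable R cut ⟨x, strG g fun i => .fm (ψ i)⟩ → Derivable R cut ⟨x, .fm (.opG g ψ)⟩
  | gR (g : L.G) (ψ : Fin (L.arG g) → L.Fm P) (y : L.ArgsG P g) :
      (∀ i, Derivable R cut (seqFm (y i) (ψ i))) → Derivable R cut ⟨.fm (.opG g ψ), strG g y⟩
  -- the additional structural rules
  | structural (r : L.StructRule) (hr : r ∈ R) (σ : (s : Side) → ℕ → L.Str P s) :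
      (∀ S ∈ r.premises, Derivable R cut (S.subst σ)) → Derivable R cut (r.conclusion.subst σ)

end LESignature

/-! The argument is semantic. Cut-free derivability is a relation between `F`-structures and
`G`-structures, and each formula is interpreted as a concept of this polarity. Two facts carry the
proof.

First (`fm_mem_interp`), the left and right introduction rules place each formula, viewed as a
structure, in both the extent and the intent of its own interpretation.

Second (`Derivable.valid`), call a sequent valid if it stays cut-free derivable whenever each
formula occurrence is replaced by a structure from the matching part of its interpretation. Every
rule preserves validity, and Cut does so because extent and intent are polars of each other.
Structural rules do so because their conclusions are linear: an instance of a substituted conclusion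
is again a substituted conclusion (`MSequent.exists_subst_of_inst`).

By the first fact a sequent is an instance of itself, so validity gives a cut-free derivation of it.
-/

namespace LESignature

variable {L : LESignature} {P : Type*} {R : Set L.StructRule}

/-! ### Interpretation of formulas in the concept lattice -/

/-- The relation `x ⇒ y` is cut-free derivable. -/
def CutFree (R : Set L.StructRule) (x : L.Str P .F) (y : L.Str P .G) : Prop :=
  Derivable R false ⟨x, y⟩

/-- The set of structures of sort `s` attached to a concept of the cut-free derivability relation:
its extent for the sort `F`, its intent for the sort `G`. -/
def conceptPart (C : Concept (L.Str P .F) (L.Str P .G) (CutFree R)) :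
    (s : Side) → Set (L.Str P s)
  | .F => C.extent
  | .G => C.intent

/-- The interpretation of formulas as concepts of the cut-free derivability relation. -/
def Fm.interp (R : Set L.StructRule) :
    L.Fm P → Concept (L.Str P .F) (L.Str P .G) (CutFree R)
  | .prop p => .ofAttributes _ {.fm (.prop p)}
  | .bot => ⊥
  | .top => ⊤
  | .and φ ψ => φ.interp R ⊓ ψ.interp R
  | .or φ ψ => φ.interp R ⊔ ψ.interp R
  | .opF f φ => .ofObjects _ {z | ∃ x, z = strF f x ∧ ∀ i, x i ∈ conceptPart ((φ i).interp R) _}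
  | .opG g ψ => .ofAttributes _ {z | ∃ y, z = strG g y ∧ ∀ i, y i ∈ conceptPart ((ψ i).interp R) _}

/-- `Str.Inst R x z`: the structure `z` is obtained from `x` by replacing each formula `φ` by
some structure in the part of the interpretation of `φ` that belongs to its sort. -/
def Str.Inst (R : Set L.StructRule) : {s : Side} → L.Str P s → L.Str P s → Prop
  | s, .fm φ, z => z ∈ conceptPart (φ.interp R) s
  | _, .con c x, z => ∃ x', z = .con c x' ∧ ∀ i, (x i).Inst R (x' i)

theorem derivable_of_mem_concept {C : Concept (L.Str P .F) (L.Str P .G) (CutFree R)}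
    {x : L.Str P .F} {y : L.Str P .G} (hx : x ∈ C.extent) (hy : y ∈ C.intent) :
    Derivable R false ⟨x, y⟩ :=
  show CutFree R x y from Concept.rel_extent_intent hx hy

theorem derivable_seqFm {s : Side} {x : L.Str P s} {φ : L.Fm P}
    (hx : x ∈ conceptPart (φ.interp R) s) (hφ : ∀ s, .fm φ ∈ conceptPart (φ.interp R) s) :
    Derivable R false (seqFm x φ) := by
  cases s
  · exact derivable_of_mem_concept hx (hφ .G)
  · exact derivable_of_mem_concept (hφ .F) hx

/-- Okada's lemma: in each case one introduction rule gives one membership and its dual rule the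
other. -/
theorem fm_mem_interp (φ : L.Fm P) : ∀ s, .fm φ ∈ conceptPart (φ.interp R) s := by
  -- Extent and intent are polars of each other, so membership reduces to derivability against the
  -- opposite part.
  have key : ∀ φ : L.Fm P, (∀ y ∈ (φ.interp R).intent, CutFree R (.fm φ) y) →
      (∀ x ∈ (φ.interp R).extent, CutFree R x (.fm φ)) →
      ∀ s, .fm φ ∈ conceptPart (φ.interp R) s := by
    rintro φ h₁ h₂ (_ | _)
    · change _ ∈ (φ.interp R).extent
      rw [← Concept.lowerPolar_intent]
      exact h₁
    · change _ ∈ (φ.interp R).intent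
      rw [← Concept.upperPolar_extent]
      exact h₂
  induction φ with
  | prop p =>
    refine key _ (fun y hy => hy ?_) (fun x hx => hx rfl)
    rintro _ rfl
    exact .id p
  | bot => exact key _ (fun y _ => .botL y) (fun x hx => hx (Set.mem_univ _))
  | top => exact key _ (fun y hy => hy (Set.mem_univ _)) (fun x _ => .topR x)
  | and φ ψ ihφ ihψ =>
    refine key _ (fun y hy => hy ⟨?_, ?_⟩) (fun x hx => ?_)
    · rw [← Concept.lowerPolar_intent]
      exact fun z hz => .andL₁ _ _ _ (derivable_of_mem_concept (ihφ .F) hz)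
    · rw [← Concept.lowerPolar_intent]
      exact fun z hz => .andL₂ _ _ _ (derivable_of_mem_concept (ihψ .F) hz)
    · exact .andR _ _ _ (derivable_of_mem_concept hx.1 (ihφ .G))
        (derivable_of_mem_concept hx.2 (ihψ .G))
  | or φ ψ ihφ ihψ =>
    refine key _ (fun y hy => ?_) (fun x hx => hx ⟨?_, ?_⟩)
    · exact .orL _ _ _ (derivable_of_mem_concept (ihφ .F) hy.1)
        (derivable_of_mem_concept (ihψ .F) hy.2)
    · rw [← Concept.upperPolar_extent]
      exact fun z hz => .orR₁ _ _ _ (derivable_of_mem_concept hz (ihφ .G))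
    · rw [← Concept.upperPolar_extent]
      exact fun z hz => .orR₂ _ _ _ (derivable_of_mem_concept hz (ihψ .G))
  | opF f φ ih =>
    refine key _ (fun y hy => ?_) (fun x hx => hx ?_)
    -- By induction `F_f` applied to the formulas themselves is one of the generating objects.
    · exact .fL _ _ _ (hy ⟨_, rfl, fun i => ih i _⟩)
    · rintro _ ⟨x, rfl, hx⟩
      exact .fR _ _ _ fun i => derivable_seqFm (hx i) (ih i)
  | opG g ψ ih =>
    refine key _ (fun y hy => hy ?_) (fun x hx => ?_)
    · rintro _ ⟨y, rfl, hy⟩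
      exact .gR _ _ _ fun i => derivable_seqFm (hy i) (ih i)
    · exact .gL _ _ _ (hx ⟨_, rfl, fun i => ih i _⟩)

/-- Rests on `fm_mem_interp` at the leaves; it brings validity back to the sequent itself. -/
theorem Str.Inst.refl {s : Side} (x : L.Str P s) : x.Inst R x := by
  induction x with
  | fm φ => exact fm_mem_interp φ _
  | con c x ih => exact ⟨x, rfl, ih⟩

/-! ### Instances of tuples with a replaced entry (for the display rules) -/

section Replace

variable {n : ℕ} {A B : Fin n → Side}

theorem Str.cast_cast {s t u : Side} (h : s = t) (h' : t = u) (x : L.Str P s) :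
    Str.cast h' (Str.cast h x) = Str.cast (h.trans h') x := by
  subst h h'; rfl

theorem Str.Inst.cast {s t : Side} (h : s = t) {x z : L.Str P s} (hx : x.Inst R z) :
    (Str.cast h x).Inst R (Str.cast h z) := by
  subst h; exact hx

theorem Str.replace_self (x : (j : Fin n) → L.Str P (A j)) (i : Fin n) {s : Side} (y : L.Str P s)
    (hi : s = B i) (hj : ∀ j, j ≠ i → A j = B j) :
    Str.replace (B := B) x i y hi hj i = Str.cast hi y := by
  simp [Str.replace]

theorem Str.replace_of_ne (x : (j : Fin n) → L.Str P (A j)) (i : Fin n) {s : Side} (y : L.Str P s)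
    (hi : s = B i) (hj : ∀ j, j ≠ i → A j = B j) {j : Fin n} (h : j ≠ i) :
    Str.replace (B := B) x i y hi hj j = Str.cast (hj j h) (x j) := by
  simp [Str.replace, h]

theorem Str.Inst.replace {x x' : (j : Fin n) → L.Str P (A j)} {i : Fin n} {s : Side}
    {y y' : L.Str P s} (hx : ∀ j, j ≠ i → (x j).Inst R (x' j)) (hy : y.Inst R y')
    (hi : s = B i) (hj : ∀ j, j ≠ i → A j = B j) (j : Fin n) :
    (Str.replace (B := B) x i y hi hj j).Inst R (Str.replace (B := B) x' i y' hi hj j) := by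
  by_cases h : j = i
  · subst h
    simpa only [Str.replace_self] using hy.cast hi
  · simpa only [Str.replace_of_ne _ _ _ _ _ h] using (hx j h).cast _

/-- An instance of a tuple with a replaced entry comes from an instance of the original tuple, whose
entry at the replaced coordinate can be prescribed, and an instance of the new entry. -/
theorem Str.Inst.exists_of_replace {x : (j : Fin n) → L.Str P (A j)} {i : Fin n} {s t : Side}
    {y : L.Str P s} {hi : s = B i} {hj : ∀ j, j ≠ i → A j = B j} {z : (j : Fin n) → L.Str P (B j)}
    (hz : ∀ j, (Str.replace (B := B) x i y hi hj j).Inst R (z j))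
    (ht : A i = t) {w : L.Str P t} (hw : (Str.cast ht (x i)).Inst R w) :
    ∃ (x' : (j : Fin n) → L.Str P (A j)) (y' : L.Str P s), (∀ j, (x j).Inst R (x' j)) ∧
      y.Inst R y' ∧ Str.cast ht (x' i) = w ∧ Str.replace (B := B) x' i y' hi hj = z := by
  subst ht hi
  -- Undo the replacement: `w` goes back to coordinate `i`, and the displaced entry `z i` is the
  -- instance of `y`.
  refine ⟨Str.replace z i w rfl fun j h => (hj j h).symm, z i, fun j => ?_, ?_, ?_, ?_⟩
  · by_cases h : j = i
    · subst h
      rw [Str.replace_self]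
      exact hw
    · have := (hz j).cast (hj j h).symm
      rw [Str.replace_of_ne _ _ _ _ _ h] at this ⊢
      rwa [Str.cast_cast] at this
  · have := hz i
    rw [Str.replace_self] at this
    exact this
  · rw [Str.replace_self]
    rfl
  · funext j
    by_cases h : j = i
    · subst h
      exact Str.replace_self ..
    · rw [Str.replace_of_ne _ _ _ _ _ h, Str.replace_of_ne _ _ _ _ _ h, Str.cast_cast]
      rfl

end Replace

/-! ### Linear metastructures and substitutions -/

section Linear

theorem MStr.subst_congr {σ τ : (s : Side) → ℕ → L.Str P s} {s : Side} (S : L.MStr s)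
    (h : ∀ t k, 0 < S.occ t k → σ t k = τ t k) : S.subst σ = S.subst τ := by
  induction S with
  | var m => exact h _ m (by simp [MStr.occ])
  | con c x ih =>
    simp only [MStr.subst]
    congr 1
    funext i
    refine ih i fun t k hk => h t k ?_
    exact hk.trans_le (Finset.single_le_sum (f := fun i => (x i).occ t k)
      (fun _ _ => Nat.zero_le _) (Finset.mem_univ i))

theorem MStr.inst_subst {σ τ : (s : Side) → ℕ → L.Str P s}
    (h : ∀ t k, (σ t k).Inst R (τ t k)) {s : Side} (S : L.MStr s) :
    (S.subst σ).Inst R (S.subst τ) := by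
  induction S with
  | var m => exact h _ m
  | con c x ih => exact ⟨_, rfl, ih⟩

/-- Substitutions for the members of a family of metastructures, no two of which share a
metavariable, can be combined into one. -/
theorem MStr.exists_common_subst {ι : Type*} [Fintype ι] {A : ι → Side} (S : ∀ i, L.MStr (A i))
    (hS : ∀ t k, ∑ i, (S i).occ t k ≤ 1) {σ : (s : Side) → ℕ → L.Str P s}
    {z : ∀ i, L.Str P (A i)}
    (h : ∀ i, ∃ τ, (S i).subst τ = z i ∧ ∀ t k, (σ t k).Inst R (τ t k)) :
    ∃ τ, (∀ i, (S i).subst τ = z i) ∧ ∀ t k, (σ t k).Inst R (τ t k) := by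
  classical
  choose τ hτ hστ using h
  -- Each metavariable follows the member that contains it; those in no member keep `σ`, which is
  -- harmless by reflexivity.
  refine ⟨fun t k => if h : ∃ i, 0 < (S i).occ t k then τ h.choose t k else σ t k,
    fun i => ?_, fun t k => ?_⟩
  · rw [← hτ i]
    refine MStr.subst_congr _ fun t k hk => ?_
    have hex : ∃ i, 0 < (S i).occ t k := ⟨i, hk⟩
    have hi : hex.choose = i := by
      by_contra hne
      have h₁ := Finset.add_le_sum (f := fun i => (S i).occ t k) (fun _ _ => Nat.zero_le _)
        (Finset.mem_univ hex.choose) (Finset.mem_univ i) hne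
      have h₂ := hex.choose_spec
      have h₃ := hS t k
      omega
    simp only [dif_pos hex, hi]
  · dsimp only
    split
    · exact hστ _ t k
    · exact .refl _

/-- The value of `τ` is read off from `z` at the only occurrence of each metavariable. With repeated
occurrences, the copies of one structure could be instantiated differently. -/
theorem MStr.exists_subst_of_inst {σ : (s : Side) → ℕ → L.Str P s} {s : Side} (S : L.MStr s)
    (hS : ∀ t k, S.occ t k ≤ 1) {z : L.Str P s} (hz : (S.subst σ).Inst R z) :
    ∃ τ, S.subst τ = z ∧ ∀ t k, (σ t k).Inst R (τ t k) := by
  classical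
  induction S with
  | @var s m =>
    refine ⟨Function.update σ s (Function.update (σ s) m z), by simp [MStr.subst], fun t k => ?_⟩
    by_cases ht : t = s
    · subst ht
      by_cases hk : k = m
      · subst hk
        simpa [MStr.subst] using hz
      · simpa [hk] using .refl _
    · simpa [ht] using .refl _
  | con c x ih =>
    obtain ⟨z, rfl, hz⟩ := hz
    obtain ⟨τ, hτ, hστ⟩ := MStr.exists_common_subst x hS fun i => ih i (fun t k =>
      (Finset.single_le_sum (f := fun i => (x i).occ t k)
        (fun _ _ => Nat.zero_le _) (Finset.mem_univ i)).trans (hS t k)) (hz i)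
    exact ⟨τ, congrArg (Str.con c) (funext hτ), hστ⟩

theorem MSequent.exists_subst_of_inst {σ : (s : Side) → ℕ → L.Str P s} (S : L.MSequent)
    (hS : ∀ t k, S.occ t k ≤ 1) {x : L.Str P .F} {y : L.Str P .G}
    (hx : (S.ant.subst σ).Inst R x) (hy : (S.suc.subst σ).Inst R y) :
    ∃ τ, S.subst τ = ⟨x, y⟩ ∧ ∀ t k, (σ t k).Inst R (τ t k) := by
  have hocc : ∀ t k, S.ant.occ t k + S.suc.occ t k ≤ 1 := hS
  obtain ⟨τ, hτ, hστ⟩ := MStr.exists_common_subst (R := R) (σ := σ)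
    -- Antecedent and succedent form a two-member family, so linearity is used jointly across the
    -- arrow.
    (A := fun b : Bool => cond b .F .G)
    (fun b => match b with | true => S.ant | false => S.suc)
    (fun t k => by simpa using hocc t k)
    (z := fun b => match b with | true => x | false => y)
    (fun b => match b with
      | true => S.ant.exists_subst_of_inst (fun t k => (Nat.le_add_right _ _).trans (hocc t k)) hx
      | false => S.suc.exists_subst_of_inst (fun t k => (Nat.le_add_left _ _).trans (hocc t k)) hy)
  exact ⟨τ, by rw [MSequent.subst, hτ true, hτ false], hστ⟩

end Linear

/-! ### Soundness of all rules, including Cut -/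

/-- A sequent is valid if all its instances are cut-free derivable. -/
def Sequent.Valid (R : Set L.StructRule) (S : L.Sequent P) : Prop :=
  ∀ x y, S.ant.Inst R x → S.suc.Inst R y → CutFree R x y

/-- The instances of `φ` on the other side are exactly the opposite part of its concept, so validity
puts `z` in the polar of that part. -/
theorem mem_interp_of_valid_seqFm {s : Side} {x z : L.Str P s} {φ : L.Fm P}
    (h : (seqFm x φ).Valid R) (hz : x.Inst R z) : z ∈ conceptPart (φ.interp R) s := by
  cases s
  · change z ∈ (φ.interp R).extent
    rw [← Concept.lowerPolar_intent]
    exact fun y hy => h z y hz hy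
  · change z ∈ (φ.interp R).intent
    rw [← Concept.upperPolar_extent]
    exact fun x hx => h x z hx hz

theorem Derivable.valid (hR : ∀ r ∈ R, r.IsAnalytic) {cut : Bool} {S : L.Sequent P}
    (h : Derivable R cut S) : S.Valid R := by
  induction h with
  | id p => exact fun x y hx hy => Concept.rel_extent_intent hx hy
  | cutRule _ x φ y _ _ ih₁ ih₂ =>
    -- The first premise makes `x'` an instance of the cut formula, so the second premise applies to
    -- it directly.
    exact fun x' y' hx hy => ih₂ x' y' (mem_interp_of_valid_seqFm (s := .F) ih₁ hx) hy
  | sharpG f i h x y _ ih =>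
    rintro w _ hw ⟨z, rfl, hz⟩
    -- The displayed structure `w` is prescribed as the `i`-th entry, which recovers an instance of
    -- the premise.
    obtain ⟨x', y', hx, hy, rfl, rfl⟩ := Str.Inst.exists_of_replace hz _ hw
    exact .sharpG f i h x' y' (ih _ _ ⟨x', rfl, hx⟩ hy)
  | sharpG_inv f i h x y _ ih =>
    rintro _ y' ⟨x', rfl, hx⟩ hy
    exact .sharpG_inv f i h x' y' (ih _ _ ((hx i).cast _)
      ⟨_, rfl, Str.Inst.replace (fun j _ => hx j) hy _ _⟩)
  | sharpF f i h x y _ ih =>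
    rintro _ w ⟨z, rfl, hz⟩ hw
    obtain ⟨x', y', hx, hy, rfl, rfl⟩ := Str.Inst.exists_of_replace hz _ hw
    exact .sharpF f i h x' y' (ih _ _ ⟨x', rfl, hx⟩ hy)
  | sharpF_inv f i h x y _ ih =>
    rintro _ y' ⟨x', rfl, hx⟩ hy
    exact .sharpF_inv f i h x' y' (ih _ _
      ⟨_, rfl, Str.Inst.replace (fun j _ => hx j) hy _ _⟩ ((hx i).cast _))
  | flatF g i h y x _ ih =>
    rintro _ w ⟨z, rfl, hz⟩ hw
    obtain ⟨y', x', hy, hx, rfl, rfl⟩ := Str.Inst.exists_of_replace hz _ hw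
    exact .flatF g i h y' x' (ih _ _ hx ⟨y', rfl, hy⟩)
  | flatF_inv g i h y x _ ih =>
    rintro x' _ hx ⟨y', rfl, hy⟩
    exact .flatF_inv g i h y' x' (ih _ _
      ⟨_, rfl, Str.Inst.replace (fun j _ => hy j) hx _ _⟩ ((hy i).cast _))
  | flatG g i h y x _ ih =>
    rintro w _ hw ⟨z, rfl, hz⟩
    obtain ⟨y', x', hy, hx, rfl, rfl⟩ := Str.Inst.exists_of_replace hz _ hw
    exact .flatG g i h y' x' (ih _ _ hx ⟨y', rfl, hy⟩)
  | flatG_inv g i h y x _ ih =>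
    rintro x' _ hx ⟨y', rfl, hy⟩
    exact .flatG_inv g i h y' x' (ih _ _ ((hy i).cast _)
      ⟨_, rfl, Str.Inst.replace (fun j _ => hy j) hx _ _⟩)
  | botL y => exact fun x y hx _ => hx (Set.mem_univ y)
  | topR x => exact fun x y _ hy => hy (Set.mem_univ x)
  | andL₁ φ ψ y _ ih => exact fun x y hx hy => ih x y hx.1 hy
  | andL₂ φ ψ y _ ih => exact fun x y hx hy => ih x y hx.2 hy
  | andR φ ψ x _ _ ih₁ ih₂ =>
    exact fun x y hx hy => Concept.rel_extent_intent (c := φ.interp R ⊓ ψ.interp R)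
      ⟨mem_interp_of_valid_seqFm (s := .F) ih₁ hx, mem_interp_of_valid_seqFm (s := .F) ih₂ hx⟩ hy
  | orR₁ φ ψ x _ ih => exact fun x y hx hy => ih x y hx hy.1
  | orR₂ φ ψ x _ ih => exact fun x y hx hy => ih x y hx hy.2
  | orL φ ψ y _ _ ih₁ ih₂ =>
    exact fun x y hx hy => Concept.rel_extent_intent (c := φ.interp R ⊔ ψ.interp R) hx
      ⟨mem_interp_of_valid_seqFm (s := .G) ih₁ hy, mem_interp_of_valid_seqFm (s := .G) ih₂ hy⟩
  | fL f φ y _ ih =>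
    -- The extent is the double polar of its generators, so it is enough to test `y'` against each
    -- generator.
    refine fun x' y' hx hy => hx ?_
    rintro _ ⟨x, rfl, hx⟩
    exact ih _ _ ⟨x, rfl, hx⟩ hy
  | fR f φ x _ ih =>
    rintro _ y' ⟨x', rfl, hx⟩ hy
    exact hy ⟨x', rfl, fun i => mem_interp_of_valid_seqFm (ih i) (hx i)⟩
  | gL g ψ x _ ih =>
    refine fun x' y' hx hy => hy ?_
    rintro _ ⟨y, rfl, hy⟩
    exact ih _ _ hx ⟨y, rfl, hy⟩
  | gR g ψ y _ ih =>
    rintro x' _ hx ⟨y', rfl, hy⟩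
    exact hx ⟨y', rfl, fun i => mem_interp_of_valid_seqFm (ih i) (hy i)⟩
  | structural r hr σ _ ih =>
    intro x y hx hy
    obtain ⟨τ, hτ, hστ⟩ := r.conclusion.exists_subst_of_inst (hR r hr).nonproliferation hx hy
    rw [CutFree, ← hτ]
    -- The same rule is applied with `τ`: its premises under `τ` are instances of those under `σ`.
    exact .structural r hr τ fun S hS =>
      ih S hS _ _ (MStr.inst_subst hστ _) (MStr.inst_subst hστ _)

end LESignature

theorem mainTheorem2 (L : LESignature.{u, v}) (AtProp : Type w) (R : Set L.StructRule)
    (hR : ∀ r ∈ R, r.IsAnalytic) (x : L.Str AtProp .F) (y : L.Str AtProp .G)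
    (h : LESignature.Derivable R true ⟨x, y⟩) : LESignature.Derivable R false ⟨x, y⟩ :=
  h.valid hR x y (.refl x) (.refl y)
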